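/- A literal is a Boolean variable or its negation. A clause is a finite set of literals containing no variable together with its negation. A CNF formula is a finite set of clauses, read as the conjunction of the disjunctions of their literals; it is a $k$-CNF formula if every clause has exactly $k$ literals. Two clauses conflict if some variable occurs positively in one of them and negatively in the other. Let $e(F)$ denote the number of conflicts in $F$, i.e. the number of unordered pairs of distinct clauses of $F$ that conflict. **Theorem 1.** (i) There is a constant $c>0$ such that for every $k\ge 1$, every unsatisfiable $k$-CNF formula $F$ (over any set of variables) satisfies $e(F)\ge c\cdot 2.69^k$. (ii) There is a constant $K>0$ such that for every $k\ge 0$ there exists an unsatisfiable $k$-CNF formula $F$ with $e(F)\le K\cdot 3.51^k$. (iii) Consequently, for every $k\ge 1$ the global conflict number $$gc(k)=\max\{e\in\mathbb{N}_0 : \text{every } k\text{-CNF formula } F \text{ with } e(F)\le e \text{ is satisfiable}\}$$ (formulas over countably many variables) is well defined, i.e. the maximum exists, and, as $k\to\infty$, $gc(k)\in\Omega(2.69^k)$ and $gc(k)\in O(3.51^k)$. -/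

import Mathlib

/-- A literal over the variables `V`: `(x, true)` is the positive literal `x`,
`(x, false)` is its negation. -/
abbrev Lit (V : Type*) := V × Bool

/-- A clause is a finite set of literals, read as their disjunction. -/
abbrev Clause (V : Type*) := Finset (Lit V)

/-- A CNF formula is a finite set of clauses, read as their conjunction. -/
abbrev CNFFormula (V : Type*) := Finset (Clause V)

/-- Every clause has exactly `k` literals and does not contain a variable together
with its negation. -/
def IsKCNF {V : Type*} (k : ℕ) (F : CNFFormula V) : Prop :=
  ∀ C ∈ F, C.card = k ∧ ∀ x : V, ¬ ((x, true) ∈ C ∧ (x, false) ∈ C)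

/-- The truth assignment `α` makes some literal of the clause `C` true. -/
def SatisfiesClause {V : Type*} (α : V → Bool) (C : Clause V) : Prop :=
  ∃ u ∈ C, α u.1 = u.2

/-- Some truth assignment satisfies all the clauses of `F`. -/
def IsSatisfiable {V : Type*} (F : CNFFormula V) : Prop :=
  ∃ α : V → Bool, ∀ C ∈ F, SatisfiesClause α C

/-- Some variable occurs positively in one of the two clauses and negatively in the other. -/
def ClausesConflict {V : Type*} (C D : Clause V) : Prop :=
  ∃ x : V, ((x, true) ∈ C ∧ (x, false) ∈ D) ∨ ((x, false) ∈ C ∧ (x, true) ∈ D)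

/-- The conflict graph of `F`: its vertices are the clauses of `F`, and two clauses are
adjacent if they conflict. -/
def conflictGraph {V : Type*} (F : CNFFormula V) : SimpleGraph {C : Clause V // C ∈ F} where
  Adj C D := C ≠ D ∧ ClausesConflict C.1 D.1
  symm := ⟨by
    rintro C D ⟨hne, x, h⟩
    exact ⟨hne.symm, x, h.elim (fun h => Or.inr ⟨h.2, h.1⟩) (fun h => Or.inl ⟨h.2, h.1⟩)⟩⟩
  loopless := ⟨fun _ h => h.1 rfl⟩

/-- `e(F)`: the number of conflicts in `F`, that is, of edges of its conflict graph. -/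
noncomputable def numConflicts {V : Type*} (F : CNFFormula V) : ℕ :=
  (conflictGraph F).edgeSet.ncard

/-- The numbers `e` such that every `k`-CNF formula with at most `e` conflicts is satisfiable. -/
def satisfiableConflictBounds (k : ℕ) : Set ℕ :=
  {e | ∀ F : CNFFormula ℕ, IsKCNF k F → numConflicts F ≤ e → IsSatisfiable F}

/-- The global conflict number `gc(k)`: the largest element of `satisfiableConflictBounds k`. -/
noncomputable def gc (k : ℕ) : ℕ := sSup (satisfiableConflictBounds k)

/-!
The theorem has two independent halves; the statements about `gc` follow from them formally.

*Lower bound.* By the lopsided Lovász local lemma (`exists_satisfying_of_local_bound`) a formula is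
satisfiable if, for independent random truth values, the violation probabilities of the clauses
conflicting with any given clause sum to at most `1 / 4`. Uniform values only give `2 ^ k`
conflicts. Two ideas improve the base: the literal of a variable that occurs more often is made
true with probability greater than `1 / 2` (`falseProb`), and every clause is replaced by a part
of it before the lemma is applied. Write `occ u` for the number of clauses containing `u` and `Δ`
for the number of clauses conflicting with a clause `C`. Every literal `u` of `C` satisfies
`occ (litNeg u) ≤ Δ`, so a literal of `C` with `occ u > Δ` is likely to be true. The part of `C`
that is kept consists of the literals with `occ u ≤ Δ`, or of those with `occ u ≤ T` for a fixed
threshold `T`, or it is all of `C`. In the first two cases the part should have violation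
probability at most about `1 / Δ` or `1 / T`; then for each literal these parts contribute little,
because the number of clauses containing it is bounded by the same quantity. In the last case
`Δ / E` is enough, where `E` bounds the number of conflicts, because the degrees sum to at
most `2 * E`. That one of the three demands can be met is a small linear program in the numbers of
literals of each kind (`exists_subclause`, `not_all_demands_fail`). All probabilities are compared
with powers of `48 / 49`; the resulting base is `(49 / 48) ^ 48 > 2.69`.

*Upper bound.* Take all positive clauses on a family `P` of `k`-sets and all negative clauses on a
family `Q` of `m`-sets, `m` about `k / 3`, of a ground set whose size is quadratic in `k`, such
that every subset of density at least `63 / 100` contains a member of `P` and every subset of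
density at least `37 / 100` one of `Q`. Then every assignment violates a clause. Greedily chosen
families have size about `(100 / 63) ^ k` and `(100 / 37) ^ m` (`exists_small_subset_cover`).
A negative clause is filled up to size `k` with `k - m` private variables, in all `2 ^ (k - m)`
sign patterns. Positive clauses do not conflict with each other, nor do negative clauses on
different sets, so there are at most `#P * #Q * 2 ^ (k - m) + #Q * 4 ^ (k - m)` conflicts, and
both terms are exponentially smaller than `3.51 ^ k`.
-/

/-! ### The lopsided Lovász local lemma for product distributions -/

section LocalLemma

open scoped Classical

variable {V : Type*}

/-- Averaging `f` over the value of the variable `x`, where `q u` is the probability that the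
literal `u` is false. The result no longer depends on the value at `x`. -/
noncomputable def litAvg (q : Lit V → ℝ) (x : V) (f : (V → Bool) → ℝ) : (V → Bool) → ℝ :=
  fun α => q (x, true) * f (Function.update α x false)
    + q (x, false) * f (Function.update α x true)

/-- The expectation of `f` when the variables in the list `l` get independent random values,
the literal `u` being false with probability `q u`, and the other variables keep the value that
they have in the argument. Working with such partial averages avoids a product measure on
`V → Bool`, where `V` may be infinite. -/
noncomputable def listAvg (q : Lit V → ℝ) : List V → ((V → Bool) → ℝ) → (V → Bool) → ℝ
  | [], f => f
  | x :: l, f => listAvg q l (litAvg q x f)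

lemma listAvg_mono {q : Lit V → ℝ} (hq : ∀ u, 0 ≤ q u) (l : List V) {f g : (V → Bool) → ℝ}
    (h : ∀ α, f α ≤ g α) (α : V → Bool) : listAvg q l f α ≤ listAvg q l g α := by
  induction l generalizing f g with
  | nil => exact h α
  | cons x l ih =>
    exact ih fun β => add_le_add (mul_le_mul_of_nonneg_left (h _) (hq _))
      (mul_le_mul_of_nonneg_left (h _) (hq _))

lemma listAvg_const_mul (q : Lit V → ℝ) (l : List V) (c : ℝ) (f : (V → Bool) → ℝ)
    (α : V → Bool) : listAvg q l (fun β => c * f β) α = c * listAvg q l f α := by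
  induction l generalizing f with
  | nil => rfl
  | cons x l ih =>
    have : litAvg q x (fun β => c * f β) = fun β => c * litAvg q x f β := by
      funext β; simp only [litAvg]; ring
    simp only [listAvg, this, ih]

lemma listAvg_add (q : Lit V → ℝ) (l : List V) (f g : (V → Bool) → ℝ) (α : V → Bool) :
    listAvg q l (fun β => f β + g β) α = listAvg q l f α + listAvg q l g α := by
  induction l generalizing f g with
  | nil => rfl
  | cons x l ih =>
    have : litAvg q x (fun β => f β + g β) = fun β => litAvg q x f β + litAvg q x g β := by
      funext β; simp only [litAvg]; ring
    simp only [listAvg, this, ih]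

lemma listAvg_const {q : Lit V → ℝ} (hq : ∀ x, q (x, true) + q (x, false) = 1) (l : List V)
    (c : ℝ) (α : V → Bool) : listAvg q l (fun _ => c) α = c := by
  induction l with
  | nil => rfl
  | cons x l ih =>
    have : litAvg q x (fun _ => c) = fun _ => c := by
      funext β; simp only [litAvg]; rw [← add_mul, hq, one_mul]
    simp only [listAvg, this, ih]

lemma listAvg_sum {q : Lit V → ℝ} (hq : ∀ x, q (x, true) + q (x, false) = 1) (l : List V)
    {ι : Type*} (s : Finset ι) (f : ι → (V → Bool) → ℝ) (α : V → Bool) :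
    listAvg q l (fun β => ∑ i ∈ s, f i β) α = ∑ i ∈ s, listAvg q l (f i) α := by
  induction s using Finset.induction_on with
  | empty => simpa using listAvg_const hq l 0 α
  | insert a s ha ih => simp only [Finset.sum_insert ha, listAvg_add, ih]

/-- The indicator of the event that `α` makes all literals of `C` false. -/
noncomputable def violInd (C : Clause V) (α : V → Bool) : ℝ :=
  if SatisfiesClause α C then 0 else 1

lemma violInd_nonneg (C : Clause V) (α : V → Bool) : 0 ≤ violInd C α := by
  unfold violInd; split_ifs <;> norm_num

lemma violInd_le_one (C : Clause V) (α : V → Bool) : violInd C α ≤ 1 := by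
  unfold violInd; split_ifs <;> norm_num

/-- Making a literal of `C` false does not increase `f`. -/
def DecreasesAlong (C : Clause V) (f : (V → Bool) → ℝ) : Prop :=
  ∀ u ∈ C, ∀ α, f (Function.update α u.1 (!u.2)) ≤ f α

lemma DecreasesAlong.litAvg {q : Lit V → ℝ} (hq : ∀ u, 0 ≤ q u) {C : Clause V}
    {f : (V → Bool) → ℝ} (hf : DecreasesAlong C f) {x : V} (hx : ∀ u ∈ C, u.1 ≠ x) :
    DecreasesAlong C (litAvg q x f) := by
  intro u hu α
  simp only [_root_.litAvg]
  rw [Function.update_comm (hx u hu), Function.update_comm (hx u hu)]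
  exact add_le_add (mul_le_mul_of_nonneg_left (hf u hu _) (hq _))
    (mul_le_mul_of_nonneg_left (hf u hu _) (hq _))

lemma satisfiesClause_update_of_forall_ne {C : Clause V} {x : V} (hx : ∀ u ∈ C, u.1 ≠ x)
    (α : V → Bool) (b : Bool) :
    SatisfiesClause (Function.update α x b) C ↔ SatisfiesClause α C := by
  unfold SatisfiesClause
  refine exists_congr fun u => and_congr_right fun hu => ?_
  rw [Function.update_of_ne (hx u hu)]

/-- The correlation inequality behind the lopsided local lemma: the event that `C` is violated
is negatively correlated with every `f` that decreases when literals of `C` become false. -/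
lemma listAvg_violInd_mul_le {q : Lit V → ℝ} (hq0 : ∀ u, 0 ≤ q u)
    (hq1 : ∀ x, q (x, true) + q (x, false) = 1) (l : List V) (C : Clause V)
    (hC : ∀ x : V, ¬ ((x, true) ∈ C ∧ (x, false) ∈ C)) (hl : ∀ u ∈ C, u.1 ∈ l)
    (f : (V → Bool) → ℝ) (hf0 : ∀ α, 0 ≤ f α) (hf : DecreasesAlong C f) (α : V → Bool) :
    listAvg q l (fun β => violInd C β * f β) α ≤ (∏ u ∈ C, q u) * listAvg q l f α := by
  induction l generalizing C f with
  | nil =>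
    have hC0 : C = ∅ := Finset.eq_empty_of_forall_notMem fun u hu => by simpa using hl u hu
    subst hC0
    simpa [listAvg] using mul_le_mul_of_nonneg_right (violInd_le_one ∅ α) (hf0 α)
  | cons x l ih =>
    have hg0 : ∀ β, 0 ≤ litAvg q x f β := fun β =>
      add_nonneg (mul_nonneg (hq0 _) (hf0 _)) (mul_nonneg (hq0 _) (hf0 _))
    by_cases hx : ∃ b, (x, b) ∈ C
    · obtain ⟨b, hb⟩ := hx
      have hne : ∀ u ∈ C.erase (x, b), u.1 ≠ x := by
        rintro ⟨y, d⟩ hu rfl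
        obtain ⟨h1, h2⟩ := Finset.mem_erase.1 hu
        cases b <;> cases d
        · exact h1 rfl
        · exact hC y ⟨h2, hb⟩
        · exact hC y ⟨hb, h2⟩
        · exact h1 rfl
      have key : ∀ β, litAvg q x (fun γ => violInd C γ * f γ) β
          ≤ q (x, b) * (violInd (C.erase (x, b)) β * litAvg q x f β) := by
        intro β
        have h1 : violInd C (Function.update β x b) = 0 :=
          if_pos ⟨(x, b), hb, by simp⟩
        have h2 : violInd C (Function.update β x (!b)) = violInd (C.erase (x, b)) β := by
          unfold violInd
          refine if_congr ?_ rfl rfl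
          rw [← satisfiesClause_update_of_forall_ne hne β (!b)]
          constructor
          · rintro ⟨u, hu, h⟩
            refine ⟨u, Finset.mem_erase.2 ⟨?_, hu⟩, h⟩
            rintro rfl
            simp at h
          · rintro ⟨u, hu, h⟩
            exact ⟨u, Finset.mem_of_mem_erase hu, h⟩
        have h3 : f (Function.update β x (!b)) ≤ f (Function.update β x b) := by
          simpa using hf (x, b) hb (Function.update β x b)
        have h4 : f (Function.update β x (!b)) ≤ litAvg q x f β := by
          have h5 := hq1 x
          have h6 := hq0 (x, true)
          have h7 := hq0 (x, false)
          have h8 := congrArg (· * f (Function.update β x (!b))) h5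
          unfold litAvg
          cases b <;> simp only [Bool.not_true, Bool.not_false] at h3 h8 ⊢ <;> nlinarith
        have h5 : litAvg q x (fun γ => violInd C γ * f γ) β
            = q (x, b) * (violInd (C.erase (x, b)) β * f (Function.update β x (!b))) := by
          unfold litAvg
          cases b <;> simp only [Bool.not_true, Bool.not_false] at h1 h2 ⊢ <;> rw [h1, h2] <;>
            ring
        rw [h5]
        exact mul_le_mul_of_nonneg_left
          (mul_le_mul_of_nonneg_left h4 (violInd_nonneg _ _)) (hq0 _)
      calc listAvg q (x :: l) (fun β => violInd C β * f β) α
          ≤ listAvg q l (fun β => q (x, b) * (violInd (C.erase (x, b)) β * litAvg q x f β)) α :=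
            listAvg_mono hq0 l key α
        _ = q (x, b) * listAvg q l (fun β => violInd (C.erase (x, b)) β * litAvg q x f β) α :=
            listAvg_const_mul ..
        _ ≤ q (x, b) * ((∏ u ∈ C.erase (x, b), q u) * listAvg q l (litAvg q x f) α) := by
            refine mul_le_mul_of_nonneg_left (ih _ ?_ ?_ _ hg0 ?_) (hq0 _)
            · exact fun y h => hC y ⟨Finset.mem_of_mem_erase h.1, Finset.mem_of_mem_erase h.2⟩
            · exact fun u hu => (List.mem_cons.1 (hl u (Finset.mem_of_mem_erase hu))).resolve_left
                (hne u hu)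
            · exact DecreasesAlong.litAvg hq0
                (fun u hu => hf u (Finset.mem_of_mem_erase hu)) hne
        _ = _ := by rw [← mul_assoc, Finset.mul_prod_erase _ _ hb]; rfl
    · have hne : ∀ u ∈ C, u.1 ≠ x := by
        rintro ⟨y, d⟩ hu rfl
        exact hx ⟨d, hu⟩
      have h1 : litAvg q x (fun γ => violInd C γ * f γ)
          = fun β => violInd C β * litAvg q x f β := by
        funext β
        simp only [litAvg, violInd, satisfiesClause_update_of_forall_ne hne]
        ring
      simp only [listAvg, h1]
      exact ih C hC
        (fun u hu => (List.mem_cons.1 (hl u hu)).resolve_left (hne u hu)) _ hg0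
        (hf.litAvg hq0 hne)

/-- The indicator of the event that `α` satisfies all clauses `C i`, `i ∈ S`. -/
noncomputable def satInd {ι : Type*} (C : ι → Clause V) (S : Finset ι) (α : V → Bool) : ℝ :=
  if ∀ i ∈ S, SatisfiesClause α (C i) then 1 else 0

lemma satInd_nonneg {ι : Type*} (C : ι → Clause V) (S : Finset ι) (α : V → Bool) :
    0 ≤ satInd C S α := by
  unfold satInd; split_ifs <;> norm_num

lemma satInd_anti {ι : Type*} (C : ι → Clause V) {S T : Finset ι} (h : S ⊆ T) (α : V → Bool) :
    satInd C T α ≤ satInd C S α := by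
  unfold satInd
  split_ifs with h1 h2
  · exact le_rfl
  · exact absurd (fun i hi => h1 i (h hi)) h2
  · norm_num
  · exact le_rfl

/-- Satisfying clauses that do not conflict with `D` only becomes harder when literals of `D`
are made false. -/
lemma satInd_decreasesAlong {ι : Type*} (C : ι → Clause V) (S : Finset ι) (D : Clause V)
    (h : ∀ i ∈ S, ¬ ClausesConflict D (C i)) : DecreasesAlong D (satInd C S) := by
  intro u hu α
  unfold satInd
  split_ifs with h1 h2
  · exact le_rfl
  · refine absurd (fun i hi => ?_) h2
    obtain ⟨v, hv, hvs⟩ := h1 i hi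
    refine ⟨v, hv, ?_⟩
    by_cases hvu : v.1 = u.1
    · refine absurd ⟨u.1, ?_⟩ (h i hi)
      rw [hvu, Function.update_self] at hvs
      obtain ⟨x, b⟩ := u
      obtain ⟨y, d⟩ := v
      cases b <;> simp_all
    · rwa [Function.update_of_ne hvu] at hvs
  · norm_num
  · exact le_rfl

/-- The lopsided Lovász local lemma: if the literals are independently false with probabilities
`q u`, no clause is too likely to be violated, and the violation probabilities of the clauses in
conflict with any given clause sum to at most `1 / 4`, then all clauses can be satisfied. -/
theorem exists_satisfying_of_local_bound {q : Lit V → ℝ} (hq0 : ∀ u, 0 ≤ q u)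
    (hq1 : ∀ x, q (x, true) + q (x, false) = 1) {ι : Type*} [Fintype ι] (C : ι → Clause V)
    (hC : ∀ i, ∀ x : V, ¬ ((x, true) ∈ C i ∧ (x, false) ∈ C i))
    (hlt : ∀ i, ∏ u ∈ C i, q u < 1 / 2)
    (hsum : ∀ i, ∑ j with ClausesConflict (C i) (C j), ∏ u ∈ C j, q u ≤ 1 / 4) :
    ∃ α : V → Bool, ∀ i, SatisfiesClause α (C i) := by
  let l : List V := (Finset.univ.biUnion fun i => (C i).image Prod.fst).toList
  have hl : ∀ i, ∀ u ∈ C i, u.1 ∈ l := by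
    intro i u hu
    simp only [l, Finset.mem_toList, Finset.mem_biUnion, Finset.mem_univ, true_and,
      Finset.mem_image]
    exact ⟨i, u, hu, rfl⟩
  let E : ((V → Bool) → ℝ) → ℝ := fun f => listAvg q l f fun _ => true
  have hE0 : ∀ S, 0 ≤ E (satInd C S) := fun S => by
    have := listAvg_mono hq0 l (satInd_nonneg C S) fun _ => true
    rwa [listAvg_const hq1] at this
  have hP0 : ∀ i, 0 ≤ ∏ u ∈ C i, q u := fun i => Finset.prod_nonneg fun u _ => hq0 u
  have main : ∀ (S : Finset ι) (i : ι),
      E (fun β => violInd (C i) β * satInd C S β) ≤ 2 * (∏ u ∈ C i, q u) * E (satInd C S) := by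
    intro S
    induction S using Finset.strongInduction with
    | H S ih =>
      intro i
      set S₁ := S.filter fun j => ClausesConflict (C i) (C j) with hS₁
      set S₂ := S.filter fun j => ¬ ClausesConflict (C i) (C j) with hS₂
      have h1 : E (fun β => violInd (C i) β * satInd C S β)
          ≤ (∏ u ∈ C i, q u) * E (satInd C S₂) :=
        (listAvg_mono hq0 l (fun β => mul_le_mul_of_nonneg_left
          (satInd_anti C (Finset.filter_subset _ S) β) (violInd_nonneg _ β)) _).trans
          (listAvg_violInd_mul_le hq0 hq1 l (C i) (hC i) (hl i) _ (satInd_nonneg C S₂)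
            (satInd_decreasesAlong C S₂ (C i) fun j hj => (Finset.mem_filter.1 hj).2) _)
      have h2 : E (satInd C S₂) ≤ 2 * E (satInd C S) := by
        rcases S₁.eq_empty_or_nonempty with h0 | ⟨j₀, hj₀⟩
        · have : S₂ = S := Finset.filter_true_of_mem fun j hj hc =>
            Finset.notMem_empty j (h0 ▸ Finset.mem_filter.2 ⟨hj, hc⟩)
          rw [this]
          linarith [hE0 S]
        · have hss : S₂ ⊂ S := by
            refine Finset.filter_ssubset.2 ⟨j₀, ?_⟩
            simpa using Finset.mem_filter.1 hj₀
          have h3 : ∀ β, satInd C S₂ β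
              ≤ satInd C S β + ∑ j ∈ S₁, violInd (C j) β * satInd C S₂ β := by
            intro β
            have hnn : ∀ j ∈ S₁, 0 ≤ violInd (C j) β * satInd C S₂ β := fun j _ =>
              mul_nonneg (violInd_nonneg _ _) (satInd_nonneg _ _ _)
            by_cases hS : ∃ j ∈ S₁, ¬ SatisfiesClause β (C j)
            · obtain ⟨j, hj, hjs⟩ := hS
              have := Finset.single_le_sum hnn hj
              rw [violInd, if_neg hjs, one_mul] at this
              linarith [satInd_nonneg C S β]
            · push Not at hS
              have : satInd C S₂ β ≤ satInd C S β := by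
                unfold satInd
                split_ifs with h4 h5
                · exact le_rfl
                · refine absurd (fun j hj => ?_) h5
                  by_cases hc : ClausesConflict (C i) (C j)
                  · exact hS j (Finset.mem_filter.2 ⟨hj, hc⟩)
                  · exact h4 j (Finset.mem_filter.2 ⟨hj, hc⟩)
                · norm_num
                · exact le_rfl
              linarith [Finset.sum_nonneg hnn]
          have h4 : E (satInd C S₂) ≤ E (satInd C S)
              + ∑ j ∈ S₁, E (fun β => violInd (C j) β * satInd C S₂ β) := by
            have := listAvg_mono hq0 l h3 fun _ => true
            rwa [listAvg_add, listAvg_sum hq1] at this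
          have h5 : ∑ j ∈ S₁, E (fun β => violInd (C j) β * satInd C S₂ β)
              ≤ ∑ j ∈ S₁, 2 * (∏ u ∈ C j, q u) * E (satInd C S₂) :=
            Finset.sum_le_sum fun j _ => ih S₂ hss j
          have h6 : ∑ j ∈ S₁, ∏ u ∈ C j, q u ≤ 1 / 4 :=
            (Finset.sum_le_sum_of_subset_of_nonneg
              (Finset.filter_subset_filter _ (Finset.subset_univ S))
              fun j _ _ => hP0 j).trans (hsum i)
          rw [← Finset.sum_mul, ← Finset.mul_sum] at h5
          nlinarith [hE0 S₂]
      calc _ ≤ _ := h1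
        _ ≤ (∏ u ∈ C i, q u) * (2 * E (satInd C S)) := mul_le_mul_of_nonneg_left h2 (hP0 i)
        _ = _ := by ring
  have pos : ∀ S : Finset ι, 0 < E (satInd C S) := by
    intro S
    induction S using Finset.induction_on with
    | empty =>
      have : satInd C ∅ = fun _ => 1 := by funext β; simp [satInd]
      rw [this]
      simp only [E, listAvg_const hq1]
      norm_num
    | insert i S _ ih =>
      have h1 : ∀ β, satInd C S β ≤ satInd C (insert i S) β + violInd (C i) β * satInd C S β := by
        intro β
        by_cases hi : SatisfiesClause β (C i)
        · have : satInd C (insert i S) β = satInd C S β := by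
            simp [satInd, hi]
          rw [this]
          linarith [mul_nonneg (violInd_nonneg (C i) β) (satInd_nonneg C S β)]
        · rw [violInd, if_neg hi]
          linarith [satInd_nonneg C (insert i S) β]
      have h2 : E (satInd C S) ≤ E (satInd C (insert i S))
          + E (fun β => violInd (C i) β * satInd C S β) := by
        have := listAvg_mono hq0 l h1 fun _ => true
        rwa [listAvg_add] at this
      have h3 := main S i
      nlinarith [hlt i]
  by_contra hcon
  push Not at hcon
  have h0 : satInd C Finset.univ = fun _ => 0 := by
    funext β
    obtain ⟨i, hi⟩ := hcon β
    exact if_neg fun h => hi (h i (Finset.mem_univ i))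
  have h1 := pos Finset.univ
  rw [h0] at h1
  simp only [E, listAvg_const hq1] at h1
  exact lt_irrefl _ h1

end LocalLemma

/-! ### Few conflicts imply satisfiability -/

section FewConflicts

open scoped Classical

variable {V ι : Type*} [Fintype ι]

/-- The complementary literal. -/
def litNeg (u : Lit V) : Lit V := (u.1, !u.2)

lemma litNeg_litNeg (u : Lit V) : litNeg (litNeg u) = u := by simp [litNeg]

/-- The number of clauses of the family `C` that contain the literal `u`. -/
noncomputable def occ (C : ι → Clause V) (u : Lit V) : ℕ :=
  (Finset.univ.filter fun i => u ∈ C i).card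

/-- The number of clauses of the family `C` that conflict with `C i`. -/
noncomputable def conflictDegree (C : ι → Clause V) (i : ι) : ℕ :=
  (Finset.univ.filter fun j => ClausesConflict (C i) (C j)).card

lemma clausesConflict_iff {A B : Clause V} : ClausesConflict A B ↔ ∃ u ∈ A, litNeg u ∈ B := by
  constructor
  · rintro ⟨x, h | h⟩
    · exact ⟨(x, true), h⟩
    · exact ⟨(x, false), h⟩
  · rintro ⟨⟨x, b⟩, h⟩
    cases b
    · exact ⟨x, Or.inr h⟩
    · exact ⟨x, Or.inl h⟩

lemma occ_litNeg_le_conflictDegree {C : ι → Clause V} {i : ι} {u : Lit V} (hu : u ∈ C i) :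
    occ C (litNeg u) ≤ conflictDegree C i :=
  Finset.card_le_card fun j hj => by
    simp only [Finset.mem_filter, Finset.mem_univ, true_and] at hj ⊢
    exact clausesConflict_iff.2 ⟨u, hu, hj⟩

lemma occ_pos {C : ι → Clause V} {i : ι} {u : Lit V} (hu : u ∈ C i) : 0 < occ C u :=
  Finset.card_pos.2 ⟨i, by simpa using hu⟩

/-- The probability that the literal `u` is false. It exceeds `1 / 2` if `u` occurs less often than
its complement, and the bias is stronger if one of the two occurs more than `T` times. -/
noncomputable def falseProb (C : ι → Clause V) (T : ℝ) (u : Lit V) : ℝ :=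
  if occ C u = occ C (litNeg u) then 1 / 2
  else if (occ C u : ℝ) ≤ T ∧ (occ C (litNeg u) : ℝ) ≤ T then
    if occ C u < occ C (litNeg u) then 597 / 1000 else 403 / 1000
  else
    if occ C u < occ C (litNeg u) then 704 / 1000 else 296 / 1000

lemma falseProb_nonneg (C : ι → Clause V) (T : ℝ) (u : Lit V) : 0 ≤ falseProb C T u := by
  unfold falseProb; split_ifs <;> norm_num

lemma falseProb_le (C : ι → Clause V) (T : ℝ) (u : Lit V) : falseProb C T u ≤ 704 / 1000 := by
  unfold falseProb; split_ifs <;> norm_num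

lemma falseProb_add (C : ι → Clause V) (T : ℝ) (x : V) :
    falseProb C T (x, true) + falseProb C T (x, false) = 1 := by
  have h1 : litNeg (x, true) = (x, false) := rfl
  have h2 : litNeg (x, false) = (x, true) := rfl
  unfold falseProb
  rw [h1, h2]
  have h3 : ((occ C (x, true) : ℝ) ≤ T ∧ (occ C (x, false) : ℝ) ≤ T) ↔
      ((occ C (x, false) : ℝ) ≤ T ∧ (occ C (x, true) : ℝ) ≤ T) := and_comm
  rcases lt_trichotomy (occ C (x, true)) (occ C (x, false)) with h | h | h
  · rw [if_neg h.ne, if_neg h.ne', if_pos h, if_neg h.not_gt, if_pos h, if_neg h.not_gt]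
    by_cases h4 : (occ C (x, true) : ℝ) ≤ T ∧ (occ C (x, false) : ℝ) ≤ T
    · rw [if_pos h4, if_pos (h3.1 h4)]; norm_num
    · rw [if_neg h4, if_neg fun h => h4 (h3.2 h)]; norm_num
  · rw [if_pos h, if_pos h.symm]
    norm_num
  · rw [if_neg h.ne, if_neg h.ne', if_pos h, if_neg h.not_gt, if_pos h, if_neg h.not_gt]
    by_cases h4 : (occ C (x, true) : ℝ) ≤ T ∧ (occ C (x, false) : ℝ) ≤ T
    · rw [if_pos h4, if_pos (h3.1 h4)]; norm_num
    · rw [if_neg h4, if_neg fun h => h4 (h3.2 h)]; norm_num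

lemma sum_biUnion_le_of_nonneg {σ τ : Type*} (s : Finset σ) (t : σ → Finset τ) (f : τ → ℝ)
    (hf : ∀ j, 0 ≤ f j) : ∑ j ∈ s.biUnion t, f j ≤ ∑ i ∈ s, ∑ j ∈ t i, f j := by
  induction s using Finset.induction_on with
  | empty => simp
  | insert a s ha ih =>
    rw [Finset.biUnion_insert, Finset.sum_insert ha]
    have := Finset.sum_union_inter (s₁ := t a) (s₂ := s.biUnion t) (f := f)
    have h0 : 0 ≤ ∑ j ∈ t a ∩ s.biUnion t, f j := Finset.sum_nonneg fun j _ => hf j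
    linarith

lemma prod_le_pow_mul_card {q : Lit V → ℝ} (hq : ∀ u, 0 ≤ q u) {ρ : ℝ} {a : ℕ}
    (s : Finset (Lit V)) (h : ∀ u ∈ s, q u ≤ ρ ^ a) : ∏ u ∈ s, q u ≤ ρ ^ (a * s.card) := by
  calc ∏ u ∈ s, q u ≤ ∏ _u ∈ s, ρ ^ a := Finset.prod_le_prod (fun u _ => hq u) h
    _ = _ := by rw [Finset.prod_const, pow_mul]

/-- The linear program behind the exponent: with `L = log (49 / 48)`, literals of the three kinds
contribute `25 * L`, `44 * L` and `59 * L` to the negative logarithm of the violation probability,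
and `k` literals suffice to meet one of the three demands on it. -/
lemma not_all_demands_fail {k : ℕ} {n₀ n₁ n₂ : ℕ} (hk : n₀ + n₁ + n₂ = k) (hk1 : 1 ≤ k)
    {M Δ : ℝ} (hM : 0 < M) (hΔ : 0 < Δ) (hT : M * Δ ≤ (49 / 48 : ℝ) ^ (31 * k))
    (h₀ : 1 < M * Δ * (48 / 49 : ℝ) ^ (25 * n₀))
    (h₁ : 1 < (49 / 48 : ℝ) ^ (31 * k) * (48 / 49 : ℝ) ^ (25 * n₀ + 44 * n₁))
    (h₂ : Δ * M < (49 / 48 : ℝ) ^ (48 * k) * (48 / 49 : ℝ) ^ (25 * n₀ + 44 * n₁ + 59 * n₂)) :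
    False := by
  set L := Real.log (49 / 48 : ℝ) with hL
  have hL0 : 0 < L := Real.log_pos (by norm_num)
  have hL' : Real.log (48 / 49 : ℝ) = -L := by rw [hL, ← Real.log_inv]; norm_num
  have hp : ∀ n : ℕ, (0 : ℝ) < (48 / 49) ^ n := fun n => by positivity
  have hr : ∀ n : ℕ, (0 : ℝ) < (49 / 48) ^ n := fun n => by positivity
  have hMΔ : 0 < M * Δ := by positivity
  set b := Real.log (M * Δ) with hb
  have g0 := Real.log_le_log hMΔ hT
  have g1 := Real.log_lt_log one_pos h₀
  have g2 := Real.log_lt_log one_pos h₁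
  have g3 := Real.log_lt_log (by positivity) h₂
  rw [Real.log_mul hMΔ.ne' (hp _).ne', Real.log_pow, hL', Real.log_one] at g1
  rw [Real.log_mul (hr _).ne' (hp _).ne', Real.log_pow, Real.log_pow, hL', Real.log_one] at g2
  rw [Real.log_mul (hr _).ne' (hp _).ne', Real.log_pow, Real.log_pow, hL', mul_comm Δ] at g3
  rw [Real.log_pow] at g0
  have hkR : (k : ℝ) = n₀ + n₁ + n₂ := by exact_mod_cast hk.symm
  have hkL : 0 < (k : ℝ) * L := mul_pos (by exact_mod_cast hk1) hL0
  push_cast at g0 g1 g2 g3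
  have e0 : 0 ≤ (n₀ : ℝ) * L := by positivity
  have e1 : 0 ≤ (n₁ : ℝ) * L := by positivity
  have e2 : 0 ≤ (n₂ : ℝ) * L := by positivity
  rw [hkR] at g0 g2 g3 hkL
  nlinarith

/-- Every clause has a part whose violation probability is small either compared with the number
of conflicts of the clause or compared with the numbers of occurrences of the literals kept. -/
lemma exists_subclause {k : ℕ} (hk : 1 ≤ k) (C : ι → Clause V) (i : ι) (hcard : (C i).card = k)
    {M E T : ℝ} (hM : 1 < M) (hE : M ^ 2 * E = (49 / 48 : ℝ) ^ (48 * k))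
    (hT : M * T = (49 / 48 : ℝ) ^ (31 * k)) (hd : 0 < conflictDegree C i) :
    ∃ D ⊆ C i, M * E * ∏ u ∈ D, falseProb C T u ≤ conflictDegree C i ∨
      (D.Nonempty ∧ ∀ u ∈ D, M * occ C u * ∏ u ∈ D, falseProb C T u ≤ 1) := by
  have hM0 : 0 < M := by linarith
  have hq := falseProb_nonneg C T
  set q := falseProb C T with hqdef
  set Δ : ℝ := (conflictDegree C i : ℝ) with hΔ
  have hΔ1 : 1 ≤ Δ := by rw [hΔ]; exact_mod_cast hd
  have hneg : ∀ u ∈ C i, (occ C (litNeg u) : ℝ) ≤ Δ := fun u hu => by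
    rw [hΔ]; exact_mod_cast occ_litNeg_le_conflictDegree hu
  have hr : ∀ n : ℕ, (48 / 49 : ℝ) ^ n * (49 / 48 : ℝ) ^ n = 1 := fun n => by
    rw [← mul_pow]; norm_num
  -- If `T < Δ`, the bound `falseProb ≤ 704 / 1000` alone makes the whole clause good enough.
  rcases lt_or_ge T Δ with hTΔ | hTΔ
  · refine ⟨C i, subset_rfl, Or.inl ?_⟩
    have h1 : ∏ u ∈ C i, q u ≤ (48 / 49 : ℝ) ^ (17 * (C i).card) :=
      prod_le_pow_mul_card hq _ fun u _ => (falseProb_le C T u).trans (by norm_num)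
    rw [hcard] at h1
    have hE0 : 0 ≤ M * E := by
      have : 0 < M ^ 2 * E := by rw [hE]; positivity
      nlinarith
    have h2 : M * (M * E * (48 / 49 : ℝ) ^ (17 * k)) = M * T := by
      rw [hT, show M * (M * E * (48 / 49 : ℝ) ^ (17 * k)) = M ^ 2 * E * (48 / 49 : ℝ) ^ (17 * k)
        by ring, hE, show 48 * k = 31 * k + 17 * k by ring, pow_add, mul_assoc,
        mul_comm ((49 / 48 : ℝ) ^ (17 * k)), hr, mul_one]
    have h3 := mul_left_cancel₀ hM0.ne' h2
    nlinarith [mul_le_mul_of_nonneg_left h1 hE0]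
  · set A₀ := (C i).filter fun u => (occ C u : ℝ) ≤ Δ with hA₀
    set A₁ := (C i).filter fun u => (occ C u : ℝ) ≤ T with hA₁
    have h01 : A₀ ⊆ A₁ := fun u hu => by
      rw [hA₀, Finset.mem_filter] at hu
      exact Finset.mem_filter.2 ⟨hu.1, hu.2.trans hTΔ⟩
    have h1C : A₁ ⊆ C i := Finset.filter_subset _ _
    have b0 : ∏ u ∈ A₀, q u ≤ (48 / 49 : ℝ) ^ (25 * A₀.card) := by
      refine prod_le_pow_mul_card hq _ fun u hu => ?_
      obtain ⟨hu1, hu2⟩ := Finset.mem_filter.1 hu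
      have h : q u ≤ 597 / 1000 := by
        have := hneg u hu1
        have h1 : (occ C u : ℝ) ≤ T ∧ (occ C (litNeg u) : ℝ) ≤ T := ⟨by linarith, by linarith⟩
        rw [hqdef, falseProb, if_pos h1]
        split_ifs <;> norm_num
      exact h.trans (by norm_num)
    have b1 : ∏ u ∈ A₁ \ A₀, q u ≤ (48 / 49 : ℝ) ^ (44 * (A₁ \ A₀).card) := by
      refine prod_le_pow_mul_card hq _ fun u hu => ?_
      obtain ⟨hu1, hu0⟩ := Finset.mem_sdiff.1 hu
      obtain ⟨hu1, hu2⟩ := Finset.mem_filter.1 hu1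
      have hu3 : Δ < occ C u := by
        by_contra hc
        exact hu0 (Finset.mem_filter.2 ⟨hu1, not_lt.1 hc⟩)
      have h1 : occ C (litNeg u) < occ C u := by exact_mod_cast (hneg u hu1).trans_lt hu3
      have h : q u ≤ 403 / 1000 := by
        rw [hqdef, falseProb, if_neg h1.ne', if_pos ⟨hu2, (hneg u hu1).trans hTΔ⟩,
          if_neg h1.not_gt]
      exact h.trans (by norm_num)
    have b2 : ∏ u ∈ C i \ A₁, q u ≤ (48 / 49 : ℝ) ^ (59 * (C i \ A₁).card) := by
      refine prod_le_pow_mul_card hq _ fun u hu => ?_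
      obtain ⟨hu1, hu0⟩ := Finset.mem_sdiff.1 hu
      have hu3 : T < occ C u := by
        by_contra hc
        exact hu0 (Finset.mem_filter.2 ⟨hu1, not_lt.1 hc⟩)
      have h1 : occ C (litNeg u) < occ C u := by
        exact_mod_cast ((hneg u hu1).trans hTΔ).trans_lt hu3
      have h : q u ≤ 296 / 1000 := by
        rw [hqdef, falseProb, if_neg h1.ne', if_neg fun h => absurd h.1 (not_le.2 hu3),
          if_neg h1.not_gt]
      exact h.trans (by norm_num)
    have p0 : ∀ s : Finset (Lit V), 0 ≤ ∏ u ∈ s, q u := fun s => Finset.prod_nonneg fun u _ => hq u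
    have b01 : ∏ u ∈ A₁, q u ≤ (48 / 49 : ℝ) ^ (25 * A₀.card + 44 * (A₁ \ A₀).card) := by
      rw [← Finset.prod_sdiff h01, pow_add, mul_comm]
      exact mul_le_mul b0 b1 (p0 _) (by positivity)
    have b012 : ∏ u ∈ C i, q u
        ≤ (48 / 49 : ℝ) ^ (25 * A₀.card + 44 * (A₁ \ A₀).card + 59 * (C i \ A₁).card) := by
      rw [← Finset.prod_sdiff h1C, pow_add, mul_comm]
      exact mul_le_mul b01 b2 (p0 _) (by positivity)
    have hcount : A₀.card + (A₁ \ A₀).card + (C i \ A₁).card = k := by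
      rw [← hcard, ← Finset.card_sdiff_add_card_eq_card h1C,
        ← Finset.card_sdiff_add_card_eq_card h01]
      ring
    have nonempty_of : ∀ (s : Finset (Lit V)) (t : ℝ), 1 < M * t →
        M * t * ∏ u ∈ s, q u ≤ 1 → s.Nonempty := by
      intro s t ht hs
      by_contra hc
      rw [Finset.not_nonempty_iff_eq_empty] at hc
      rw [hc, Finset.prod_empty] at hs
      linarith
    have good_of : ∀ (s : Finset (Lit V)) (t : ℝ), (∀ u ∈ s, (occ C u : ℝ) ≤ t) →
        M * t * ∏ u ∈ s, q u ≤ 1 → ∀ u ∈ s, M * occ C u * ∏ u ∈ s, q u ≤ 1 := by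
      intro s t ht hs u hu
      refine le_trans ?_ hs
      exact mul_le_mul_of_nonneg_right (mul_le_mul_of_nonneg_left (ht u hu) hM0.le) (p0 s)
    have hMT : 1 < M * T := by
      rw [hT]
      exact one_lt_pow₀ (by norm_num) (by omega)
    by_cases c0 : M * Δ * ∏ u ∈ A₀, q u ≤ 1
    · exact ⟨A₀, h01.trans h1C, Or.inr ⟨nonempty_of A₀ Δ (by nlinarith) c0,
        good_of A₀ Δ (fun u hu => (Finset.mem_filter.1 hu).2) c0⟩⟩
    by_cases c1 : M * T * ∏ u ∈ A₁, q u ≤ 1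
    · exact ⟨A₁, h1C, Or.inr ⟨nonempty_of A₁ T hMT c1,
        good_of A₁ T (fun u hu => (Finset.mem_filter.1 hu).2) c1⟩⟩
    by_cases c2 : M * E * ∏ u ∈ C i, q u ≤ Δ
    · exact ⟨C i, subset_rfl, Or.inl c2⟩
    push Not at c0 c1 c2
    have hME : 0 < M * E := by
      have : 0 < M * (M * E) := by rw [← mul_assoc, ← sq, hE]; positivity
      exact pos_of_mul_pos_right this hM0.le
    refine (not_all_demands_fail hcount hk hM0 (by linarith : 0 < Δ) ?_ ?_ ?_ ?_).elim
    · rw [← hT]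
      exact mul_le_mul_of_nonneg_left hTΔ hM0.le
    · exact c0.trans_le (mul_le_mul_of_nonneg_left b0 (by positivity))
    · rw [← hT]
      exact c1.trans_le (mul_le_mul_of_nonneg_left b01 (by linarith))
    · rw [← hE, sq, mul_assoc M M E, mul_comm Δ, mul_assoc]
      exact mul_lt_mul_of_pos_left
        (c2.trans_le (mul_le_mul_of_nonneg_left b012 hME.le)) hM0

/-- A `k`-CNF formula, given as a family of clauses, is satisfiable if it has at most
`(49 / 48) ^ (48 * k) / (16 * k) ^ 2` conflicts; the sum of the degrees counts each twice. -/
theorem exists_satisfying_of_sum_conflictDegree_le {k : ℕ} (hk : 1 ≤ k) (C : ι → Clause V)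
    (hcard : ∀ i, (C i).card = k) (hC : ∀ i, ∀ x : V, ¬ ((x, true) ∈ C i ∧ (x, false) ∈ C i))
    (h : ∑ i, (conflictDegree C i : ℝ) ≤ 2 * ((49 / 48 : ℝ) ^ (48 * k) / (16 * k) ^ 2)) :
    ∃ α : V → Bool, ∀ i, SatisfiesClause α (C i) := by
  set M : ℝ := 16 * k with hM
  have hkR : (1 : ℝ) ≤ k := by exact_mod_cast hk
  have hM16 : 16 ≤ M := by linarith
  have hM0 : 0 < M := by linarith
  set E : ℝ := (49 / 48 : ℝ) ^ (48 * k) / M ^ 2 with hE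
  set T : ℝ := (49 / 48 : ℝ) ^ (31 * k) / M with hT
  have hE0 : 0 < E := by positivity
  have hE' : M ^ 2 * E = (49 / 48 : ℝ) ^ (48 * k) := by rw [hE]; field_simp
  have hT' : M * T = (49 / 48 : ℝ) ^ (31 * k) := by rw [hT]; field_simp
  have hq := falseProb_nonneg C T
  have hq1 := falseProb_add C T
  have hle := falseProb_le C T
  set q := falseProb C T with hqdef
  have hd2 : ∀ i, (conflictDegree C i : ℝ) ≤ 2 * E := fun i =>
    (Finset.single_le_sum (f := fun i => (conflictDegree C i : ℝ))
      (fun j _ => Nat.cast_nonneg _) (Finset.mem_univ i)).trans h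
  have hp0 : ∀ s : Finset (Lit V), 0 ≤ ∏ u ∈ s, q u := fun s => Finset.prod_nonneg fun u _ => hq u
  -- A clause without conflicts needs no truncation: all its literals are likely to be true.
  have hex : ∀ i, ∃ D ⊆ C i, ∏ u ∈ D, q u < 1 / 2 ∧ (0 < conflictDegree C i → ∀ u ∈ D,
      ∏ u ∈ D, q u ≤ conflictDegree C i / (M * E) + 1 / (M * occ C u)) := by
    intro i
    rcases Nat.eq_zero_or_pos (conflictDegree C i) with h0 | hpos
    · refine ⟨C i, subset_rfl, ?_, fun h => absurd h (by omega)⟩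
      have hne : (C i).Nonempty := Finset.card_pos.1 (by rw [hcard]; omega)
      obtain ⟨u, hu⟩ := hne
      have hu1 : q u ≤ 403 / 1000 := by
        have h1 := occ_litNeg_le_conflictDegree hu
        have h2 := occ_pos hu
        have h3 : occ C (litNeg u) < occ C u := by omega
        rw [hqdef, falseProb, if_neg h3.ne', if_neg h3.not_gt, if_neg h3.not_gt]
        split_ifs <;> norm_num
      have h4 : ∏ v ∈ (C i).erase u, q v ≤ 1 :=
        Finset.prod_le_one (fun v _ => hq v) fun v _ => (hle v).trans (by norm_num)
      rw [← Finset.mul_prod_erase _ _ hu]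
      nlinarith [hq u, hp0 ((C i).erase u)]
    · obtain ⟨D, hD, hD1⟩ := exists_subclause hk C i (hcard i) (by linarith) hE' hT' hpos
      refine ⟨D, hD, ?_, ?_⟩
      · rcases hD1 with h1 | ⟨⟨u, hu⟩, h1⟩
        · have h2 : M * E * ∏ u ∈ D, q u ≤ 2 * E := h1.trans (hd2 i)
          have h3 : M * ∏ u ∈ D, q u ≤ 2 := by
            refine le_of_mul_le_mul_left ?_ hE0
            calc E * (M * ∏ u ∈ D, q u) = M * E * ∏ u ∈ D, q u := by ring
              _ ≤ 2 * E := h2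
              _ = E * 2 := by ring
          nlinarith [hp0 D]
        · have h2 : (1 : ℝ) ≤ occ C u := by exact_mod_cast occ_pos (hD hu)
          have h3 := h1 u hu
          have h4 : M * ∏ u ∈ D, q u ≤ 1 := by
            refine le_trans ?_ h3
            exact mul_le_mul_of_nonneg_right (by nlinarith) (hp0 D)
          nlinarith [hp0 D]
      · intro _ u hu
        have h2 : (0 : ℝ) < occ C u := by exact_mod_cast occ_pos (hD hu)
        rcases hD1 with h1 | ⟨_, h1⟩
        · have h3 : ∏ u ∈ D, q u ≤ conflictDegree C i / (M * E) := by
            rw [le_div_iff₀ (by positivity), mul_comm]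
            exact h1
          have : 0 ≤ 1 / (M * occ C u) := by positivity
          linarith
        · have h3 : ∏ u ∈ D, q u ≤ 1 / (M * occ C u) := by
            rw [le_div_iff₀ (by positivity), mul_comm]
            exact h1 u hu
          have : 0 ≤ (conflictDegree C i : ℝ) / (M * E) := by positivity
          linarith
  choose D hDC hlt hD using hex
  have hlit : ∀ v : Lit V,
      ∑ j with v ∈ D j ∧ 0 < conflictDegree C j, ∏ u ∈ D j, q u ≤ 3 / M := by
    intro v
    calc ∑ j with v ∈ D j ∧ 0 < conflictDegree C j, ∏ u ∈ D j, q u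
        ≤ ∑ j with v ∈ D j ∧ 0 < conflictDegree C j,
            ((conflictDegree C j : ℝ) / (M * E) + 1 / (M * occ C v)) :=
          Finset.sum_le_sum fun j hj => by
            obtain ⟨-, h1, h2⟩ := Finset.mem_filter.1 hj
            exact hD j h2 v h1
      _ = ∑ j with v ∈ D j ∧ 0 < conflictDegree C j, (conflictDegree C j : ℝ) / (M * E)
          + ∑ j with v ∈ D j ∧ 0 < conflictDegree C j, 1 / (M * (occ C v : ℝ)) :=
          Finset.sum_add_distrib
      _ ≤ 2 / M + 1 / M := by
          refine add_le_add ?_ ?_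
          · calc ∑ j with v ∈ D j ∧ 0 < conflictDegree C j, (conflictDegree C j : ℝ) / (M * E)
                ≤ ∑ j, (conflictDegree C j : ℝ) / (M * E) :=
                  Finset.sum_le_sum_of_subset_of_nonneg (Finset.filter_subset _ _)
                    fun j _ _ => by positivity
              _ ≤ 2 * E / (M * E) := by
                  rw [← Finset.sum_div]
                  exact div_le_div_of_nonneg_right h (by positivity)
              _ = 2 / M := by field_simp
          · have h1 : (Finset.univ.filter fun j => v ∈ D j ∧ 0 < conflictDegree C j).card
                ≤ occ C v := Finset.card_le_card fun j hj => by
              simp only [Finset.mem_filter, Finset.mem_univ, true_and] at hj ⊢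
              exact hDC j hj.1
            rw [Finset.sum_const, nsmul_eq_mul]
            rcases Nat.eq_zero_or_pos (occ C v) with h0 | hpos
            · rw [h0] at h1
              rw [Nat.le_zero.1 h1, Nat.cast_zero, zero_mul]
              positivity
            · have h2 : (0 : ℝ) < occ C v := by exact_mod_cast hpos
              have h3 : ((Finset.univ.filter fun j => v ∈ D j ∧ 0 < conflictDegree C j).card : ℝ)
                ≤ occ C v := by exact_mod_cast h1
              rw [mul_one_div, div_le_div_iff₀ (by positivity) hM0]
              nlinarith
      _ = 3 / M := by ring
  obtain ⟨α, hα⟩ := exists_satisfying_of_local_bound hq hq1 D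
    (fun i x hx => hC i x ⟨hDC i hx.1, hDC i hx.2⟩) hlt fun i => by
    have hsub : (Finset.univ.filter fun j => ClausesConflict (D i) (D j))
        ⊆ (D i).biUnion fun u =>
          Finset.univ.filter fun j => litNeg u ∈ D j ∧ 0 < conflictDegree C j := by
      intro j hj
      obtain ⟨u, hu, huj⟩ := clausesConflict_iff.1 (Finset.mem_filter.1 hj).2
      simp only [Finset.mem_biUnion, Finset.mem_filter, Finset.mem_univ, true_and]
      refine ⟨u, hu, huj, Finset.card_pos.2 ⟨i, ?_⟩⟩
      simp only [Finset.mem_filter, Finset.mem_univ, true_and]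
      exact clausesConflict_iff.2 ⟨litNeg u, hDC j huj, by rw [litNeg_litNeg]; exact hDC i hu⟩
    calc ∑ j with ClausesConflict (D i) (D j), ∏ u ∈ D j, q u
        ≤ ∑ j ∈ (D i).biUnion fun u =>
            Finset.univ.filter fun j => litNeg u ∈ D j ∧ 0 < conflictDegree C j,
              ∏ u ∈ D j, q u :=
          Finset.sum_le_sum_of_subset_of_nonneg hsub fun j _ _ => hp0 _
      _ ≤ ∑ u ∈ D i, ∑ j with litNeg u ∈ D j ∧ 0 < conflictDegree C j, ∏ u ∈ D j, q u :=
          sum_biUnion_le_of_nonneg _ _ _ fun j => hp0 _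
      _ ≤ ∑ _u ∈ D i, 3 / M := Finset.sum_le_sum fun u _ => hlit (litNeg u)
      _ = (D i).card * (3 / M) := by rw [Finset.sum_const, nsmul_eq_mul]
      _ ≤ k * (3 / M) := by
          refine mul_le_mul_of_nonneg_right ?_ (by positivity)
          rw [← hcard i]
          exact_mod_cast Finset.card_le_card (hDC i)
      _ ≤ 1 / 4 := by
          rw [hM, mul_div_assoc', div_le_div_iff₀ (by positivity) (by norm_num)]
          linarith
  exact ⟨α, fun i => (hα i).imp fun u hu => ⟨hDC i hu.1, hu.2⟩⟩

end FewConflicts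

/-! ### Small families of sets that hit all large sets from below -/

section Covering

open scoped Classical

/-- Greedy covering: if every element of `X` is related to a fraction `δ` of `Y`, then some `m`
elements of `Y` suffice for all of `X`, provided that `#X * (1 - δ) ^ m < 1`. -/
lemma exists_small_cover {α β : Type*} (Y : Finset β) (hY : Y.Nonempty) (R : α → β → Prop)
    {δ : ℝ} (hδ : δ ≤ 1) (m : ℕ) (X : Finset α)
    (h : ∀ a ∈ X, δ * Y.card ≤ (Y.filter fun b => R a b).card)
    (hm : X.card * (1 - δ) ^ m < 1) :
    ∃ Z ⊆ Y, Z.card ≤ m ∧ ∀ a ∈ X, ∃ b ∈ Z, R a b := by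
  induction m generalizing X with
  | zero =>
    have hX : X = ∅ := by
      rw [pow_zero, mul_one] at hm
      exact Finset.card_eq_zero.1 (by exact_mod_cast Nat.lt_one_iff.1 (by exact_mod_cast hm))
    exact ⟨∅, Finset.empty_subset _, le_rfl, by simp [hX]⟩
  | succ m ih =>
    have hdouble : ∑ a ∈ X, (Y.filter fun b => R a b).card
        = ∑ b ∈ Y, (X.filter fun a => R a b).card :=
      Finset.sum_card_bipartiteAbove_eq_sum_card_bipartiteBelow R
    obtain ⟨b, hb, hbX⟩ : ∃ b ∈ Y, δ * X.card ≤ (X.filter fun a => R a b).card := by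
      refine Finset.exists_le_of_sum_le hY ?_
      calc ∑ _b ∈ Y, δ * (X.card : ℝ) = ∑ _a ∈ X, δ * (Y.card : ℝ) := by
            simp only [Finset.sum_const, nsmul_eq_mul]; ring
        _ ≤ ∑ a ∈ X, ((Y.filter fun b => R a b).card : ℝ) := Finset.sum_le_sum h
        _ = ∑ b ∈ Y, ((X.filter fun a => R a b).card : ℝ) := by exact_mod_cast hdouble
    have hsplit := Finset.card_filter_add_card_filter_not (s := X) (fun a => R a b)
    have hsplitR : ((X.filter fun a => R a b).card : ℝ) + (X.filter fun a => ¬ R a b).card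
        = X.card := by exact_mod_cast hsplit
    obtain ⟨Z, hZ, hcard, hcov⟩ := ih (X.filter fun a => ¬ R a b)
      (fun a ha => h a (Finset.mem_filter.1 ha).1) (by
        refine lt_of_le_of_lt ?_ hm
        rw [pow_succ', ← mul_assoc]
        exact mul_le_mul_of_nonneg_right (by linarith) (pow_nonneg (by linarith) m))
    refine ⟨insert b Z, Finset.insert_subset hb hZ, (Finset.card_insert_le _ _).trans (by omega),
      fun a ha => ?_⟩
    by_cases hR : R a b
    · exact ⟨b, Finset.mem_insert_self _ _, hR⟩
    · obtain ⟨c, hc, hRc⟩ := hcov a (Finset.mem_filter.2 ⟨ha, hR⟩)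
      exact ⟨c, Finset.mem_insert_of_mem hc, hRc⟩

/-- With `j` of order at most the square root of `N`, sampling `j` elements without replacement
is up to a constant factor the same as sampling with replacement. -/
lemma half_ratio_pow_mul_choose_le {a j N : ℕ} (ha : 0 < a) (hN : 0 < N)
    (hj : 2 * j ^ 2 ≤ a * N) :
    (a / 100 : ℝ) ^ j / 2 * ((100 * N).choose j : ℝ) ≤ ((a * N).choose j : ℝ) := by
  have haN : (0 : ℝ) < a * N := by positivity
  have hjR : 2 * (j : ℝ) ^ 2 ≤ a * N := by exact_mod_cast hj
  have hjle : j ≤ a * N := by nlinarith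
  have h1 : ((100 * N).descFactorial j : ℝ) ≤ (100 * N : ℝ) ^ j := by
    exact_mod_cast Nat.descFactorial_le_pow (100 * N) j
  have h2 : ((a * N : ℝ) - j) ^ j ≤ ((a * N).descFactorial j : ℝ) := by
    have h3 : (((a * N + 1 - j : ℕ) : ℝ)) ^ j ≤ ((a * N).descFactorial j : ℝ) := by
      exact_mod_cast Nat.pow_sub_le_descFactorial (a * N) j
    refine le_trans (pow_le_pow_left₀ ?_ ?_ j) h3
    · have : (j : ℝ) ≤ a * N := by exact_mod_cast hjle
      linarith
    · rw [Nat.cast_sub (by omega)]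
      push_cast
      linarith
  have h3 : (a * N : ℝ) ^ j / 2 ≤ ((a * N : ℝ) - j) ^ j := by
    have hx : (j : ℝ) / (a * N) ≤ 1 := by
      rw [div_le_one haN]; exact_mod_cast hjle
    have h4 := one_add_mul_le_pow (a := -((j : ℝ) / (a * N))) (by linarith) j
    have h5 : ((a * N : ℝ) - j) ^ j = (a * N : ℝ) ^ j * (1 + -((j : ℝ) / (a * N))) ^ j := by
      rw [← mul_pow]; congr 1; field_simp; ring
    have h6 : (j : ℝ) * -((j : ℝ) / (a * N)) ≥ -(1 / 2) := by
      rw [mul_neg, ge_iff_le, neg_le_neg_iff, mul_div_assoc', div_le_div_iff₀ haN two_pos]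
      nlinarith
    rw [h5]
    have : (0 : ℝ) < (a * N : ℝ) ^ j := by positivity
    nlinarith
  rw [Nat.descFactorial_eq_factorial_mul_choose] at h1 h2
  push_cast at h1 h2
  have hf : (0 : ℝ) < j.factorial := by exact_mod_cast j.factorial_pos
  have h7 : (a / 100 : ℝ) ^ j * (100 * N : ℝ) ^ j = (a * N : ℝ) ^ j := by
    rw [← mul_pow]; congr 1; ring
  refine le_of_mul_le_mul_left ?_ hf
  calc (j.factorial : ℝ) * ((a / 100 : ℝ) ^ j / 2 * ((100 * N).choose j : ℝ))
      = (a / 100 : ℝ) ^ j / 2 * (j.factorial * ((100 * N).choose j : ℝ)) := by ring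
    _ ≤ (a / 100 : ℝ) ^ j / 2 * (100 * N : ℝ) ^ j :=
        mul_le_mul_of_nonneg_left h1 (by positivity)
    _ = (a * N : ℝ) ^ j / 2 := by rw [← h7]; ring
    _ ≤ _ := h3.trans h2

/-- Few `j`-sets suffice to have one inside every subset of density at least `a / 100` of the
ground set: up to a factor linear in its size, the number `(100 / a) ^ j` that is needed at
least. -/
lemma exists_small_subset_cover {a j N : ℕ} (ha : 0 < a) (ha' : a ≤ 100) (hN : 0 < N)
    (hj : 2 * j ^ 2 ≤ a * N) :
    ∃ P ⊆ Finset.powersetCard j (Finset.univ : Finset (Fin (100 * N))),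
      (P.card : ℝ) ≤ 201 * N * (100 / a : ℝ) ^ j ∧
      ∀ T : Finset (Fin (100 * N)), a * N ≤ T.card → ∃ s ∈ P, s ⊆ T := by
  have haR : (0 : ℝ) < a := by exact_mod_cast ha
  have haR' : (a : ℝ) ≤ 100 := by exact_mod_cast ha'
  have hNR : (1 : ℝ) ≤ N := by exact_mod_cast hN
  set δ : ℝ := (a / 100 : ℝ) ^ j / 2 with hδ
  have hδ0 : 0 < δ := by positivity
  have hpow1 : (a / 100 : ℝ) ^ j ≤ 1 := pow_le_one₀ (by positivity) (by linarith)
  have hδ1 : δ ≤ 1 := by linarith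
  have hjle : j ≤ 100 * N := by nlinarith
  set m : ℕ := ⌈(100 * N : ℝ) / δ⌉₊ with hm
  have hm1 : (100 * N : ℝ) / δ ≤ m := Nat.le_ceil _
  have hm2 : (m : ℝ) < (100 * N : ℝ) / δ + 1 := Nat.ceil_lt_add_one (by positivity)
  obtain ⟨P, hP, hcard, hcov⟩ := exists_small_cover
    (Finset.powersetCard j (Finset.univ : Finset (Fin (100 * N))))
    (Finset.powersetCard_nonempty.2 (by simpa using hjle))
    (fun (T s : Finset (Fin (100 * N))) => s ⊆ T) hδ1 m
    (Finset.univ.filter fun T => a * N ≤ T.card) (by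
      intro T hT
      have hT1 : a * N ≤ T.card := (Finset.mem_filter.1 hT).2
      calc δ * ((Finset.powersetCard j (Finset.univ : Finset (Fin (100 * N)))).card : ℝ)
          ≤ ((Finset.powersetCard j T).card : ℝ) := by
            rw [Finset.card_powersetCard, Finset.card_powersetCard, Finset.card_univ,
              Fintype.card_fin]
            exact (half_ratio_pow_mul_choose_le ha hN hj).trans
              (by exact_mod_cast Nat.choose_le_choose j hT1)
        _ = _ := by
            refine congrArg _ (congrArg Finset.card ?_)
            ext s
            simp [Finset.mem_powersetCard, and_comm]) (by
      have h1 : ((Finset.univ.filter fun T : Finset (Fin (100 * N)) => a * N ≤ T.card).card : ℝ)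
          ≤ 2 ^ (100 * N) := by
        have := Finset.card_filter_le (Finset.univ : Finset (Finset (Fin (100 * N))))
          fun T => a * N ≤ T.card
        rw [Finset.card_univ, Fintype.card_finset, Fintype.card_fin] at this
        exact_mod_cast this
      have h2 : (1 - δ) ^ m ≤ Real.exp (-(1 : ℝ)) ^ (100 * N) := by
        calc (1 - δ) ^ m ≤ Real.exp (-δ) ^ m :=
              pow_le_pow_left₀ (by linarith) (Real.one_sub_le_exp_neg δ) m
          _ = Real.exp (m * -δ) := by rw [Real.exp_nat_mul]
          _ ≤ Real.exp ((100 * N : ℕ) * -1) := by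
              rw [Real.exp_le_exp]
              rw [div_le_iff₀ hδ0] at hm1
              push_cast
              linarith
          _ = _ := by rw [Real.exp_nat_mul]
      calc _ ≤ (2 : ℝ) ^ (100 * N) * Real.exp (-(1 : ℝ)) ^ (100 * N) :=
            mul_le_mul h1 h2 (pow_nonneg (by linarith) m) (by positivity)
        _ = (2 * Real.exp (-1)) ^ (100 * N) := by rw [mul_pow]
        _ < 1 := by
            refine pow_lt_one₀ (by positivity) ?_ (by omega)
            rw [Real.exp_neg, ← div_eq_mul_inv, div_lt_one (Real.exp_pos 1)]
            exact lt_trans (by norm_num) Real.exp_one_gt_d9)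
  refine ⟨P, hP, ?_, fun T hT => hcov T (by simpa using hT)⟩
  have h1 : (100 / a : ℝ) ^ j = ((a / 100 : ℝ) ^ j)⁻¹ := by rw [← inv_pow, inv_div]
  have h2 : (100 * N : ℝ) / δ = 200 * N * (100 / a : ℝ) ^ j := by
    rw [h1, hδ]; field_simp; ring
  have h3 : (1 : ℝ) ≤ (100 / a : ℝ) ^ j := one_le_pow₀ (by rw [le_div_iff₀ haR]; linarith)
  have h4 : (P.card : ℝ) ≤ m := by exact_mod_cast hcard
  nlinarith

end Covering

/-! ### Unsatisfiable formulas with few conflicts -/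

section Construction

open scoped Classical

lemma numConflicts_le_card {V : Type*} (F : CNFFormula V) (R : Finset (Clause V × Clause V))
    (h : ∀ C ∈ F, ∀ D ∈ F, C ≠ D → ClausesConflict C D → (C, D) ∈ R ∨ (D, C) ∈ R) :
    numConflicts F ≤ R.card := by
  have hinj : Function.Injective (Sym2.map (Subtype.val : {C : Clause V // C ∈ F} → Clause V)) :=
    Sym2.map.injective Subtype.val_injective
  have hsub : Sym2.map (Subtype.val : {C : Clause V // C ∈ F} → Clause V) ''
      (conflictGraph F).edgeSet ⊆ (R.image fun p => s(p.1, p.2) : Finset (Sym2 (Clause V))) := by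
    rintro _ ⟨e, he, rfl⟩
    induction e using Sym2.ind with
    | _ C D =>
      obtain ⟨hne, hc⟩ := he
      rw [Sym2.map_mk, Finset.coe_image]
      rcases h C.1 C.2 D.1 D.2 (fun h => hne (Subtype.ext h)) hc with h1 | h1
      · exact ⟨_, h1, rfl⟩
      · exact ⟨_, h1, Sym2.eq_swap⟩
  calc numConflicts F
      = (Sym2.map (Subtype.val : {C : Clause V // C ∈ F} → Clause V) ''
        (conflictGraph F).edgeSet).ncard := (Set.ncard_image_of_injective _ hinj).symm
    _ ≤ ((R.image fun p => s(p.1, p.2) : Finset (Sym2 (Clause V))) : Set _).ncard :=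
        Set.ncard_le_ncard hsub (Finset.finite_toSet _)
    _ ≤ R.card := by rw [Set.ncard_coe_finset]; exact Finset.card_image_le

/-- The clause `C` with its variables renamed by `e`. -/
def renameClause {V W : Type*} (e : V ↪ W) (C : Clause V) : Clause W :=
  C.map (e.prodMap (Function.Embedding.refl Bool))

lemma mem_renameClause {V W : Type*} {e : V ↪ W} {C : Clause V} {x : V} {b : Bool} :
    (e x, b) ∈ renameClause e C ↔ (x, b) ∈ C := by
  simp [renameClause]

lemma exists_of_mem_renameClause {V W : Type*} {e : V ↪ W} {C : Clause V} {y : W} {b : Bool}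
    (h : (y, b) ∈ renameClause e C) : ∃ x, e x = y ∧ (x, b) ∈ C := by
  obtain ⟨⟨x, c⟩, hx, h⟩ := Finset.mem_map.1 h
  obtain ⟨h1, rfl⟩ := Prod.ext_iff.1 h
  exact ⟨x, h1, hx⟩

lemma clausesConflict_of_renameClause {V W : Type*} {e : V ↪ W} {C D : Clause V}
    (h : ClausesConflict (renameClause e C) (renameClause e D)) : ClausesConflict C D := by
  obtain ⟨y, h⟩ := h
  obtain ⟨x, rfl⟩ : ∃ x, e x = y := by
    rcases h with h | h <;> exact (exists_of_mem_renameClause h.1).imp fun _ h => h.1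
  simp only [mem_renameClause] at h
  exact ⟨x, h⟩

/-- Only the number of variables matters: a formula over a countable type can be moved to `ℕ`. -/
lemma exists_formula_nat_of_countable {V : Type*} [Countable V] {k : ℕ} {F : CNFFormula V}
    (hF : IsKCNF k F) (hunsat : ¬ IsSatisfiable F) (R : Finset (Clause V × Clause V))
    (h : ∀ C ∈ F, ∀ D ∈ F, C ≠ D → ClausesConflict C D → (C, D) ∈ R ∨ (D, C) ∈ R) :
    ∃ G : CNFFormula ℕ, IsKCNF k G ∧ ¬ IsSatisfiable G ∧ numConflicts G ≤ R.card := by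
  obtain ⟨f, hf⟩ := Countable.exists_injective_nat V
  let e : V ↪ ℕ := ⟨f, hf⟩
  refine ⟨F.image (renameClause e), ?_, ?_, ?_⟩
  · intro C' hC'
    obtain ⟨C, hC, rfl⟩ := Finset.mem_image.1 hC'
    refine ⟨by rw [renameClause, Finset.card_map, (hF C hC).1], ?_⟩
    rintro y ⟨h1, h2⟩
    obtain ⟨x, rfl, h3⟩ := exists_of_mem_renameClause h1
    exact (hF C hC).2 x ⟨h3, mem_renameClause.1 h2⟩
  · rintro ⟨α, hα⟩
    refine hunsat ⟨fun x => α (e x), fun C hC => ?_⟩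
    obtain ⟨⟨y, b⟩, hu, hs⟩ := hα _ (Finset.mem_image_of_mem _ hC)
    obtain ⟨x, rfl, hx⟩ := exists_of_mem_renameClause hu
    exact ⟨(x, b), hx, hs⟩
  · refine (numConflicts_le_card _ (R.image fun p => (renameClause e p.1, renameClause e p.2))
      ?_).trans Finset.card_image_le
    intro C' hC' D' hD' hne hc
    obtain ⟨C, hC, rfl⟩ := Finset.mem_image.1 hC'
    obtain ⟨D, hD, rfl⟩ := Finset.mem_image.1 hD'
    exact (h C hC D hD (fun h => hne (h ▸ rfl)) (clausesConflict_of_renameClause hc)).imp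
      (fun h => Finset.mem_image_of_mem _ h) (fun h => Finset.mem_image_of_mem _ h)

/-- The variables of the construction: the elements of a ground set `X`, and `d` private padding
variables for every subset of `X`. -/
abbrev PaddedVar (X : Type*) (d : ℕ) := X ⊕ (Finset X × Fin d)

variable {X : Type*} {d : ℕ}

/-- The clause that consists of the positive literals of the variables in `s`. -/
noncomputable def positiveClause (d : ℕ) (s : Finset X) : Clause (PaddedVar X d) :=
  s.image fun x => (Sum.inl x, true)

/-- The clause that consists of the negative literals of the variables in `s` and of the private
padding literals of `s` with signs `π`. -/
noncomputable def paddedNegativeClause (s : Finset X) (π : Fin d → Bool) :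
    Clause (PaddedVar X d) :=
  (s.image fun x => (Sum.inl x, false)) ∪ Finset.univ.image fun i => (Sum.inr (s, i), π i)

lemma inl_mem_positiveClause {s : Finset X} {x : X} {b : Bool} :
    (Sum.inl x, b) ∈ positiveClause d s ↔ x ∈ s ∧ b = true := by
  simp only [positiveClause, Finset.mem_image, Prod.mk.injEq, Sum.inl.injEq]
  constructor
  · rintro ⟨y, hy, rfl, rfl⟩
    exact ⟨hy, rfl⟩
  · rintro ⟨h, rfl⟩
    exact ⟨x, h, rfl, rfl⟩

lemma inr_notMem_positiveClause {s : Finset X} {p : Finset X × Fin d} {b : Bool} :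
    (Sum.inr p, b) ∉ positiveClause d s := by
  simp [positiveClause]

lemma inl_mem_paddedNegativeClause {s : Finset X} {π : Fin d → Bool} {x : X} {b : Bool} :
    (Sum.inl x, b) ∈ paddedNegativeClause s π ↔ x ∈ s ∧ b = false := by
  simp only [paddedNegativeClause, Finset.mem_union, Finset.mem_image, Prod.mk.injEq,
    Sum.inl.injEq, reduceCtorEq, false_and, and_false, exists_false, or_false]
  constructor
  · rintro ⟨y, hy, rfl, rfl⟩
    exact ⟨hy, rfl⟩
  · rintro ⟨h, rfl⟩
    exact ⟨x, h, rfl, rfl⟩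

lemma inr_mem_paddedNegativeClause {s t : Finset X} {π : Fin d → Bool} {i : Fin d} {b : Bool} :
    (Sum.inr (t, i), b) ∈ paddedNegativeClause s π ↔ t = s ∧ b = π i := by
  simp only [paddedNegativeClause, Finset.mem_union, Finset.mem_image, Finset.mem_univ, true_and,
    Prod.mk.injEq, Sum.inr.injEq, reduceCtorEq, false_and, and_false,
    exists_false, false_or]
  constructor
  · rintro ⟨j, ⟨h1, h2⟩, h3⟩
    exact ⟨h1.symm, by rw [← h3, h2]⟩
  · rintro ⟨rfl, rfl⟩
    exact ⟨i, ⟨rfl, rfl⟩, rfl⟩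

/-- All positive clauses on the sets in `P`, and all padded negative clauses on the sets
in `N`. -/
noncomputable def paddedFormula (d : ℕ) (P N : Finset (Finset X)) : CNFFormula (PaddedVar X d) :=
  P.image (positiveClause d) ∪
    (N ×ˢ (Finset.univ : Finset (Fin d → Bool))).image fun q => paddedNegativeClause q.1 q.2

lemma mem_paddedFormula {P N : Finset (Finset X)} {C : Clause (PaddedVar X d)} :
    C ∈ paddedFormula d P N ↔ (∃ s ∈ P, positiveClause d s = C) ∨
      ∃ s ∈ N, ∃ π : Fin d → Bool, paddedNegativeClause s π = C := by
  simp [paddedFormula]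

lemma isKCNF_paddedFormula {m : ℕ} {P N : Finset (Finset X)} (hP : ∀ s ∈ P, s.card = m + d)
    (hN : ∀ s ∈ N, s.card = m) : IsKCNF (m + d) (paddedFormula d P N) := by
  intro C hC
  rcases mem_paddedFormula.1 hC with ⟨s, hs, rfl⟩ | ⟨s, hs, π, rfl⟩
  · refine ⟨by rw [positiveClause, Finset.card_image_of_injective _ fun x y h => by simpa using h,
      hP s hs], ?_⟩
    rintro (x | p) ⟨h1, h2⟩
    · exact absurd (inl_mem_positiveClause.1 h2).2 (by simp)
    · exact inr_notMem_positiveClause h1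
  · refine ⟨?_, ?_⟩
    · rw [paddedNegativeClause, Finset.card_union_of_disjoint,
        Finset.card_image_of_injective _ fun x y h => by simpa using h,
        Finset.card_image_of_injective _ fun i j h => by simpa using (Prod.ext_iff.1 h).1,
        hN s hs, Finset.card_univ, Fintype.card_fin]
      rw [Finset.disjoint_left]
      simp only [Finset.mem_image]
      rintro _ ⟨x, -, rfl⟩ ⟨i, -, h⟩
      simp at h
    · rintro (x | ⟨t, i⟩) ⟨h1, h2⟩
      · exact absurd (inl_mem_paddedNegativeClause.1 h1).2 (by simp)
      · exact absurd ((inr_mem_paddedNegativeClause.1 h1).2.trans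
          (inr_mem_paddedNegativeClause.1 h2).2.symm) (by simp)

lemma not_isSatisfiable_paddedFormula {P N : Finset (Finset X)}
    (h : ∀ T : Set X, (∃ s ∈ P, ∀ x ∈ s, x ∉ T) ∨ ∃ s ∈ N, ∀ x ∈ s, x ∈ T) :
    ¬ IsSatisfiable (paddedFormula d P N) := by
  rintro ⟨α, hα⟩
  rcases h {x | α (Sum.inl x) = true} with ⟨s, hs, h1⟩ | ⟨s, hs, h1⟩
  · obtain ⟨⟨x | p, b⟩, hu, hsat⟩ := hα _ (mem_paddedFormula.2 (Or.inl ⟨s, hs, rfl⟩))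
    · obtain ⟨hx, rfl⟩ := inl_mem_positiveClause.1 hu
      exact h1 x hx hsat
    · exact inr_notMem_positiveClause hu
  · obtain ⟨⟨x | ⟨t, i⟩, b⟩, hu, hsat⟩ := hα _ (mem_paddedFormula.2
      (Or.inr ⟨s, hs, fun i => !α (Sum.inr (s, i)), rfl⟩))
    · obtain ⟨hx, rfl⟩ := inl_mem_paddedNegativeClause.1 hu
      have h2 : α (Sum.inl x) = true := h1 x hx
      simp [h2] at hsat
    · obtain ⟨rfl, rfl⟩ := inr_mem_paddedNegativeClause.1 hu
      simp at hsat

/-- The pairs of clauses of the padded formula that may conflict: a positive with a negative one,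
and two negative ones on the same set. -/
noncomputable def paddedConflicts (d : ℕ) (P N : Finset (Finset X)) :
    Finset (Clause (PaddedVar X d) × Clause (PaddedVar X d)) :=
  (P ×ˢ N ×ˢ (Finset.univ : Finset (Fin d → Bool))).image
      (fun q => (positiveClause d q.1, paddedNegativeClause q.2.1 q.2.2)) ∪
    (N ×ˢ (Finset.univ : Finset (Fin d → Bool)) ×ˢ (Finset.univ : Finset (Fin d → Bool))).image
      fun q => (paddedNegativeClause q.1 q.2.1, paddedNegativeClause q.1 q.2.2)

lemma card_paddedConflicts_le (P N : Finset (Finset X)) :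
    (paddedConflicts d P N).card ≤ P.card * (N.card * 2 ^ d) + N.card * (2 ^ d * 2 ^ d) := by
  refine (Finset.card_union_le _ _).trans (add_le_add ?_ ?_) <;>
    refine Finset.card_image_le.trans ?_ <;>
    simp [Finset.card_product]

lemma mem_paddedConflicts {P N : Finset (Finset X)} {C D : Clause (PaddedVar X d)}
    (hC : C ∈ paddedFormula d P N) (hD : D ∈ paddedFormula d P N) (h : ClausesConflict C D) :
    (C, D) ∈ paddedConflicts d P N ∨ (D, C) ∈ paddedConflicts d P N := by
  rcases mem_paddedFormula.1 hC with ⟨s, hs, rfl⟩ | ⟨s, hs, π, rfl⟩ <;>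
    rcases mem_paddedFormula.1 hD with ⟨t, ht, rfl⟩ | ⟨t, ht, ρ, rfl⟩
  · obtain ⟨x | p, ⟨h1, h2⟩ | ⟨h1, h2⟩⟩ := h
    · exact absurd (inl_mem_positiveClause.1 h2).2 (by simp)
    · exact absurd (inl_mem_positiveClause.1 h1).2 (by simp)
    · exact absurd h1 inr_notMem_positiveClause
    · exact absurd h1 inr_notMem_positiveClause
  · exact Or.inl (Finset.mem_union_left _ (Finset.mem_image.2 ⟨(s, t, ρ), by simp [hs, ht], rfl⟩))
  · exact Or.inr (Finset.mem_union_left _ (Finset.mem_image.2 ⟨(t, s, π), by simp [hs, ht], rfl⟩))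
  · obtain rfl : s = t := by
      obtain ⟨x | ⟨r, i⟩, ⟨h1, h2⟩ | ⟨h1, h2⟩⟩ := h
      · exact absurd (inl_mem_paddedNegativeClause.1 h1).2 (by simp)
      · exact absurd (inl_mem_paddedNegativeClause.1 h2).2 (by simp)
      all_goals
        exact (inr_mem_paddedNegativeClause.1 h1).1.symm.trans
          (inr_mem_paddedNegativeClause.1 h2).1
    exact Or.inl (Finset.mem_union_right _ (Finset.mem_image.2 ⟨(s, π, ρ), by simp [hs], rfl⟩))

/-- The padded formula on a ground set of `100 * N` elements: a set `T` of true variables with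
`#T ≥ 37 * N` violates a negative clause, and otherwise at least `63 * N` variables are false. -/
lemma exists_unsatisfiable_formula (m d : ℕ) :
    ∃ F : CNFFormula ℕ, IsKCNF (m + d) F ∧ ¬ IsSatisfiable F ∧
      (numConflicts F : ℝ) ≤ (201 * ((m + d : ℝ) ^ 2 + 1)) ^ 2 *
        ((100 / 63) ^ (m + d) * (100 / 37) ^ m * 2 ^ d + (100 / 37) ^ m * 4 ^ d) := by
  set N : ℕ := (m + d) ^ 2 + 1 with hN
  obtain ⟨P, hPsub, hPcard, hPcov⟩ := exists_small_subset_cover (a := 63) (j := m + d) (N := N)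
    (by norm_num) (by norm_num) (by omega) (by omega)
  obtain ⟨Q, hQsub, hQcard, hQcov⟩ := exists_small_subset_cover (a := 37) (j := m) (N := N)
    (by norm_num) (by norm_num) (by omega) (by
      have : m ^ 2 ≤ (m + d) ^ 2 := Nat.pow_le_pow_left (by omega) 2
      omega)
  obtain ⟨F, hF, hunsat, hcard⟩ := exists_formula_nat_of_countable
    (isKCNF_paddedFormula (d := d) (fun s hs => (Finset.mem_powersetCard.1 (hPsub hs)).2)
      fun s hs => (Finset.mem_powersetCard.1 (hQsub hs)).2)
    (not_isSatisfiable_paddedFormula (P := P) (N := Q) fun T => by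
      have hT := Finset.card_filter_add_card_filter_not
        (s := (Finset.univ : Finset (Fin (100 * N)))) (fun x => x ∈ T)
      rw [Finset.card_univ, Fintype.card_fin] at hT
      rcases le_or_gt (63 * N) (Finset.univ.filter fun x => x ∉ T).card with h | h
      · obtain ⟨s, hs, hsT⟩ := hPcov _ h
        exact Or.inl ⟨s, hs, fun x hx => (Finset.mem_filter.1 (hsT hx)).2⟩
      · obtain ⟨s, hs, hsT⟩ := hQcov (Finset.univ.filter fun x => x ∈ T) (by omega)
        exact Or.inr ⟨s, hs, fun x hx => (Finset.mem_filter.1 (hsT hx)).2⟩)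
    (paddedConflicts d P Q) fun C hC D hD _ h => mem_paddedConflicts hC hD h
  refine ⟨F, hF, hunsat, ?_⟩
  have h1 : (numConflicts F : ℝ) ≤ P.card * (Q.card * 2 ^ d) + Q.card * (2 ^ d * 2 ^ d) := by
    exact_mod_cast hcard.trans (card_paddedConflicts_le P Q)
  have hNR : (N : ℝ) = (m + d : ℝ) ^ 2 + 1 := by rw [hN]; push_cast; ring
  have h4 : (2 : ℝ) ^ d * 2 ^ d = 4 ^ d := by rw [← mul_pow]; norm_num
  rw [← hNR]
  push_cast at hPcard hQcard
  set A := (100 / 63 : ℝ) ^ (m + d)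
  set B := (100 / 37 : ℝ) ^ m
  have hA : 0 < A := by positivity
  have hB : 0 < B := by positivity
  set c : ℝ := 201 * N with hc
  have hc1 : 1 ≤ c := by
    have : (1 : ℝ) ≤ N := by exact_mod_cast (by omega : 1 ≤ N)
    linarith
  rw [h4] at h1
  calc (numConflicts F : ℝ) ≤ P.card * (Q.card * 2 ^ d) + Q.card * 4 ^ d := h1
    _ ≤ (c * A) * ((c * B) * 2 ^ d) + (c * B) * 4 ^ d := by gcongr
    _ ≤ (c * A) * ((c * B) * 2 ^ d) + (c ^ 2 * B) * 4 ^ d := by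
        gcongr
        nlinarith
    _ = c ^ 2 * (A * B * 2 ^ d + B * 4 ^ d) := by ring

end Construction

/-! ### The global conflict number -/

section Bounds

open scoped Classical

lemma exists_pow_mul_pow_le (n : ℕ) {t : ℝ} (ht0 : 0 ≤ t) (ht1 : t < 1) :
    ∃ B : ℝ, 0 < B ∧ ∀ k : ℕ, (k : ℝ) ^ n * t ^ k ≤ B := by
  obtain ⟨B, hB⟩ := (tendsto_pow_const_mul_const_pow_of_lt_one n ht0 ht1).bddAbove_range
  exact ⟨max B 1, by positivity, fun k => (hB ⟨k, rfl⟩).trans (le_max_left _ _)⟩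

lemma sum_conflictDegree_eq {V : Type*} {k : ℕ} {F : CNFFormula V} (hF : IsKCNF k F) :
    ∑ i : {C : Clause V // C ∈ F}, conflictDegree Subtype.val i = 2 * numConflicts F := by
  have h1 : ∀ i : {C : Clause V // C ∈ F},
      conflictDegree Subtype.val i = (conflictGraph F).degree i := by
    intro i
    rw [conflictDegree, ← SimpleGraph.card_neighborFinset_eq_degree]
    congr 1
    ext j
    simp only [Finset.mem_filter, Finset.mem_univ, true_and, SimpleGraph.mem_neighborFinset]
    refine ⟨fun h => ⟨?_, h⟩, fun h => h.2⟩
    rintro rfl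
    obtain ⟨x, h | h⟩ := h
    · exact (hF _ i.2).2 x h
    · exact (hF _ i.2).2 x h.symm
  rw [Finset.sum_congr rfl fun i _ => h1 i, SimpleGraph.sum_degrees_eq_twice_card_edges,
    numConflicts, Set.ncard_eq_toFinset_card', SimpleGraph.edgeFinset]

theorem lt_numConflicts_of_not_isSatisfiable {V : Type*} {k : ℕ} (hk : 1 ≤ k) {F : CNFFormula V}
    (hF : IsKCNF k F) (hunsat : ¬ IsSatisfiable F) :
    (49 / 48 : ℝ) ^ (48 * k) / (16 * k) ^ 2 < numConflicts F := by
  by_contra hcon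
  refine hunsat ?_
  obtain ⟨α, hα⟩ := exists_satisfying_of_sum_conflictDegree_le hk
    (Subtype.val : {C : Clause V // C ∈ F} → Clause V) (fun i => (hF i.1 i.2).1)
    (fun i => (hF i.1 i.2).2) (by
      have h : ∑ i : {C : Clause V // C ∈ F}, (conflictDegree Subtype.val i : ℝ)
          = 2 * numConflicts F := by exact_mod_cast sum_conflictDegree_eq hF
      rw [h]
      linarith)
  exact ⟨α, fun C hC => hα ⟨C, hC⟩⟩

/-- The numerical margin is `(48 / 49) ^ 48 * 2.69 < 1`. -/
theorem exists_le_numConflicts :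
    ∃ c : ℝ, 0 < c ∧ ∀ (V : Type*) (k : ℕ), 1 ≤ k →
      ∀ F : CNFFormula V, IsKCNF k F → ¬ IsSatisfiable F →
        c * (2.69 : ℝ) ^ k ≤ (numConflicts F : ℝ) := by
  obtain ⟨B, hB, hBk⟩ := exists_pow_mul_pow_le 2 (t := 2.69 * (48 / 49) ^ 48)
    (by norm_num) (by norm_num)
  refine ⟨1 / (256 * B), by positivity, fun V k hk F hF hunsat => ?_⟩
  refine le_trans ?_ (lt_numConflicts_of_not_isSatisfiable hk hF hunsat).le
  have hkR : (0 : ℝ) < k := by exact_mod_cast hk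
  have h1 : (48 / 49 : ℝ) ^ (48 * k) * (49 / 48) ^ (48 * k) = 1 := by rw [← mul_pow]; norm_num
  have h2 := hBk k
  rw [mul_pow, ← pow_mul] at h2
  rw [div_mul_eq_mul_div, one_mul, div_le_div_iff₀ (by positivity) (by positivity)]
  have h3 : (0 : ℝ) < (49 / 48) ^ (48 * k) := by positivity
  calc (2.69 : ℝ) ^ k * (16 * k) ^ 2
      = 256 * ((k : ℝ) ^ 2 * (2.69 ^ k * (48 / 49) ^ (48 * k))) * (49 / 48) ^ (48 * k) := by
        rw [show 256 * ((k : ℝ) ^ 2 * (2.69 ^ k * (48 / 49) ^ (48 * k))) * (49 / 48) ^ (48 * k)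
          = 256 * (k : ℝ) ^ 2 * 2.69 ^ k * ((48 / 49) ^ (48 * k) * (49 / 48) ^ (48 * k)) by ring,
          h1]
        ring
    _ ≤ 256 * B * (49 / 48) ^ (48 * k) := by gcongr
    _ = _ := by ring

/-- The numerical margin is `16 * (100 / 37) < 3.51 ^ 3`; the factor `0.999998` leaves room for
the polynomial factor. -/
theorem exists_numConflicts_le :
    ∃ K : ℝ, 0 < K ∧ ∀ k : ℕ,
      ∃ F : CNFFormula ℕ, IsKCNF k F ∧ ¬ IsSatisfiable F ∧
        (numConflicts F : ℝ) ≤ K * (3.51 : ℝ) ^ k := by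
  obtain ⟨B, hB, hBk⟩ := exists_pow_mul_pow_le 4 (t := 0.999998) (by norm_num) (by norm_num)
  refine ⟨201 ^ 2 * 32 * (2 * B + 2), by positivity, fun k => ?_⟩
  obtain ⟨F, hF, hunsat, hcard⟩ := exists_unsatisfiable_formula (k / 3) (k - k / 3)
  have hk : k / 3 + (k - k / 3) = k := by omega
  have hkR : ((k / 3 : ℕ) : ℝ) + ((k - k / 3 : ℕ) : ℝ) = k := by exact_mod_cast hk
  rw [hkR, hk] at hcard
  rw [hk] at hF
  refine ⟨F, hF, hunsat, hcard.trans ?_⟩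
  set m := k / 3 with hm
  set r := k % 3 with hr
  have hd : k - m = 2 * m + r := by omega
  have hk3 : k = 3 * m + r := by omega
  have hr2 : r ≤ 2 := by omega
  set t : ℝ := 0.999998 with ht
  have ht0 : 0 < t := by rw [ht]; norm_num
  have ht1 : t ≤ 1 := by rw [ht]; norm_num
  have hpow : (1600 / 37 : ℝ) ^ m ≤ (3.51 * t) ^ k := by
    calc (1600 / 37 : ℝ) ^ m ≤ ((3.51 * t) ^ 3) ^ m :=
          pow_le_pow_left₀ (by norm_num) (by rw [ht]; norm_num) m
      _ = (3.51 * t) ^ (3 * m) := by rw [pow_mul]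
      _ ≤ (3.51 * t) ^ k := pow_le_pow_right₀ (by rw [ht]; norm_num) (by omega)
  have e1 : (100 / 63 : ℝ) ^ k * (100 / 37) ^ m * 2 ^ (k - m) ≤ 16 * (3.51 * t) ^ k := by
    calc (100 / 63 : ℝ) ^ k * (100 / 37) ^ m * 2 ^ (k - m)
        = ((100 / 63) ^ 3 * (100 / 37) * 2 ^ 2) ^ m * (100 / 63 * 2) ^ r := by
          rw [hd]
          nth_rw 1 [hk3]
          simp only [mul_pow, pow_add, pow_mul]
          ring
      _ ≤ (1600 / 37) ^ m * 4 ^ r := by gcongr <;> norm_num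
      _ ≤ (1600 / 37) ^ m * 4 ^ 2 := by gcongr; norm_num
      _ ≤ _ := by linarith
  have e2 : (100 / 37 : ℝ) ^ m * 4 ^ (k - m) ≤ 16 * (3.51 * t) ^ k := by
    calc (100 / 37 : ℝ) ^ m * 4 ^ (k - m) = (100 / 37 * 4 ^ 2) ^ m * 4 ^ r := by
          rw [hd]
          simp only [mul_pow, pow_add, pow_mul]
          ring
      _ ≤ (1600 / 37) ^ m * 4 ^ r := by gcongr; norm_num
      _ ≤ (1600 / 37) ^ m * 4 ^ 2 := by gcongr; norm_num
      _ ≤ _ := by linarith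
  have htk : t ^ k ≤ 1 := pow_le_one₀ ht0.le ht1
  have htk0 : 0 < t ^ k := by positivity
  have hpoly : ((k : ℝ) ^ 2 + 1) ^ 2 * t ^ k ≤ 2 * B + 2 := by
    have h1 : ((k : ℝ) ^ 2 + 1) ^ 2 ≤ 2 * (k : ℝ) ^ 4 + 2 := by
      nlinarith [sq_nonneg ((k : ℝ) ^ 2 - 1)]
    have h2 := mul_le_mul_of_nonneg_right h1 htk0.le
    linarith [hBk k]
  calc (201 * ((k : ℝ) ^ 2 + 1)) ^ 2 *
        ((100 / 63) ^ k * (100 / 37) ^ m * 2 ^ (k - m) + (100 / 37) ^ m * 4 ^ (k - m))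
      ≤ (201 * ((k : ℝ) ^ 2 + 1)) ^ 2 * (32 * (3.51 * t) ^ k) := by
        refine mul_le_mul_of_nonneg_left ?_ (by positivity)
        linarith
    _ = 201 ^ 2 * 32 * (((k : ℝ) ^ 2 + 1) ^ 2 * t ^ k) * 3.51 ^ k := by
        rw [mul_pow (3.51 : ℝ), mul_pow]; ring
    _ ≤ 201 ^ 2 * 32 * (2 * B + 2) * 3.51 ^ k := by gcongr

/-- Boundedness of the set comes from the unsatisfiable formulas; it contains `0` because
unsatisfiable formulas have conflicts. -/
theorem isGreatest_gc {k : ℕ} (hk : 1 ≤ k) : IsGreatest (satisfiableConflictBounds k) (gc k) := by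
  obtain ⟨c, hc, h⟩ := exists_le_numConflicts.{0}
  obtain ⟨K, -, hK⟩ := exists_numConflicts_le
  obtain ⟨F, hF, hunsat, -⟩ := hK k
  have hbdd : BddAbove (satisfiableConflictBounds k) :=
    ⟨numConflicts F, fun e he => le_of_lt (by
      by_contra hle
      exact hunsat (he F hF (not_lt.1 hle)))⟩
  have hne : (satisfiableConflictBounds k).Nonempty := by
    refine ⟨0, fun G hG h0 => ?_⟩
    by_contra hG'
    have h1 := h ℕ k hk G hG hG'
    rw [Nat.le_zero.1 h0, Nat.cast_zero] at h1
    have : 0 < c * (2.69 : ℝ) ^ k := by positivity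
    linarith
  exact ⟨Nat.sSup_mem hne hbdd, fun e he => le_csSup hbdd he⟩

theorem gc_lt_numConflicts {k : ℕ} (hk : 1 ≤ k) {F : CNFFormula ℕ} (hF : IsKCNF k F)
    (hunsat : ¬ IsSatisfiable F) : gc k < numConflicts F := by
  by_contra h
  exact hunsat ((isGreatest_gc hk).1 F hF (not_lt.1 h))

theorem exists_numConflicts_le_gc_add_one {k : ℕ} (hk : 1 ≤ k) :
    ∃ F : CNFFormula ℕ, IsKCNF k F ∧ ¬ IsSatisfiable F ∧ numConflicts F ≤ gc k + 1 := by
  by_contra hcon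
  push Not at hcon
  have h : gc k + 1 ∈ satisfiableConflictBounds k := fun F hF hle => by
    by_contra hunsat
    exact absurd hle (not_le.2 (hcon F hF hunsat))
  have := (isGreatest_gc hk).2 h
  omega

theorem isBigO_pow_gc :
    (fun k : ℕ => (2.69 : ℝ) ^ k) =O[Filter.atTop] (fun k : ℕ => (gc k : ℝ)) := by
  obtain ⟨c, hc, h⟩ := exists_le_numConflicts.{0}
  have hlarge : ∀ᶠ k : ℕ in Filter.atTop, 2 / c ≤ (2.69 : ℝ) ^ k :=
    (tendsto_pow_atTop_atTop_of_one_lt (by norm_num)).eventually_ge_atTop _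
  refine Asymptotics.IsBigO.of_bound (2 / c) ?_
  filter_upwards [hlarge, Filter.eventually_ge_atTop 1] with k hk hk1
  obtain ⟨F, hF, hunsat, hle⟩ := exists_numConflicts_le_gc_add_one hk1
  have h1 := h ℕ k hk1 F hF hunsat
  have h2 : (numConflicts F : ℝ) ≤ gc k + 1 := by exact_mod_cast hle
  rw [Real.norm_of_nonneg (by positivity), Real.norm_of_nonneg (Nat.cast_nonneg _),
    div_mul_eq_mul_div, le_div_iff₀ hc]
  rw [div_le_iff₀ hc] at hk
  linarith

theorem isBigO_gc_pow :
    (fun k : ℕ => (gc k : ℝ)) =O[Filter.atTop] (fun k : ℕ => (3.51 : ℝ) ^ k) := by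
  obtain ⟨K, -, hK⟩ := exists_numConflicts_le
  refine Asymptotics.IsBigO.of_bound K ?_
  filter_upwards [Filter.eventually_ge_atTop 1] with k hk1
  obtain ⟨F, hF, hunsat, hle⟩ := hK k
  have h1 : (gc k : ℝ) ≤ numConflicts F := by exact_mod_cast (gc_lt_numConflicts hk1 hF hunsat).le
  rw [Real.norm_of_nonneg (Nat.cast_nonneg _), Real.norm_of_nonneg (by positivity)]
  exact h1.trans hle

end Bounds

theorem theorem1 :
    (∃ c : ℝ, 0 < c ∧ ∀ (V : Type*) (k : ℕ), 1 ≤ k →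
      ∀ F : CNFFormula V, IsKCNF k F → ¬ IsSatisfiable F →
        c * (2.69 : ℝ) ^ k ≤ (numConflicts F : ℝ)) ∧
    (∃ K : ℝ, 0 < K ∧ ∀ k : ℕ,
      ∃ F : CNFFormula ℕ, IsKCNF k F ∧ ¬ IsSatisfiable F ∧
        (numConflicts F : ℝ) ≤ K * (3.51 : ℝ) ^ k) ∧
    (∀ k : ℕ, 1 ≤ k → IsGreatest (satisfiableConflictBounds k) (gc k)) ∧
    (fun k : ℕ => (2.69 : ℝ) ^ k) =O[Filter.atTop] (fun k : ℕ => (gc k : ℝ)) ∧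
    (fun k : ℕ => (gc k : ℝ)) =O[Filter.atTop] (fun k : ℕ => (3.51 : ℝ) ^ k) := by
  exact ⟨exists_le_numConflicts, exists_numConflicts_le, fun k hk => isGreatest_gc hk,
    isBigO_pow_gc, isBigO_gc_pow⟩
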